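/- Let $\Sigma$ be a finite alphabet with at least two letters. A nonempty word $u\in\Sigma^*$ is called periodic if $u=v^n$ for some word $v\in\Sigma^*$ and some natural number $n\ge 2$, and primitive otherwise; let $Q\subseteq\Sigma^*$ be the set of all primitive words over $\Sigma$. Then $Q$ is deterministic context-sensitive, that is, there are a deterministic Turing machine $M$ (with finitely many tapes, tape symbols and states) and a constant $c\in\mathbb{N}$ such that $M$ halts on every input $w\in\Sigma^*$, accepts $w$ if and only if $w\in Q$, and in its computation on $w$ touches with its heads at most $c\cdot\max(1,|w|)$ tape cells. Moreover, $Q$ is not a regular language. -/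

import Mathlib

namespace PrimitiveWords

/-! ### Periodic and primitive words -/

/-- The power `v ^ n` of a word in the free monoid of words. -/
def wordPow {α : Type*} (v : List α) : ℕ → List α
  | 0 => []
  | n + 1 => wordPow v n ++ v

/-- A nonempty word is periodic if it is a power of some word with exponent at least two. -/
def IsPeriodicWord {α : Type*} (u : List α) : Prop :=
  u ≠ [] ∧ ∃ (v : List α) (n : ℕ), 2 ≤ n ∧ u = wordPow v n

/-- A nonempty word is primitive if it is not periodic. -/
def IsPrimitiveWord {α : Type*} (u : List α) : Prop :=
  u ≠ [] ∧ ¬ IsPeriodicWord u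

/-- The language of all primitive words over the alphabet `α`. -/
def primitiveWords (α : Type*) : Language α :=
  {u | IsPrimitiveWord u}

/-! ### Deterministic multitape Turing machines -/

/-- The possible head movements in one step. -/
inductive Move where
  | left
  | stay
  | right

/-- The displacement of the head caused by a movement. -/
def Move.toInt : Move → ℤ
  | .left => -1
  | .stay => 0
  | .right => 1

/-- The tape symbols: the blank `none`, the letters of the input alphabet `α`, and the additional
work symbols from `Γ`. -/
abbrev TapeSymbol (α Γ : Type*) := Option (α ⊕ Γ)

/-- A deterministic Turing machine with `k + 1` tapes, input alphabet `α`, additional work symbols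
`Γ` and states `S`. Given the state and the scanned symbols, `transition` either returns `none`
(the machine halts), or the new state, the symbols to be written on the scanned cells, and
the subsequent head movements. (Finiteness of `α`, `Γ` and `S` is required where machines
are used.) -/
structure DetTM (α Γ S : Type*) (k : ℕ) where
  /-- The initial state. -/
  start : S
  /-- The accepting states. -/
  accept : Set S
  /-- The transition function. -/
  transition : S → (Fin (k + 1) → TapeSymbol α Γ) →
    Option (S × (Fin (k + 1) → TapeSymbol α Γ) × (Fin (k + 1) → Move))

/-- A configuration: the current state, the head positions, and the contents of the tapes, which
are infinite in both directions. -/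
structure Config (α Γ S : Type*) (k : ℕ) where
  /-- The current state. -/
  state : S
  /-- The position of the head on each tape. -/
  head : Fin (k + 1) → ℤ
  /-- The content of each tape. -/
  tape : Fin (k + 1) → ℤ → TapeSymbol α Γ

namespace DetTM

variable {α Γ S : Type*} {k : ℕ}

/-- The initial configuration on input `w`: the word `w` stands on tape `0` in the cells
`0, …, |w| - 1`, all other cells are blank, and all heads are on cell `0` of their tape. -/
def init (M : DetTM α Γ S k) (w : List α) : Config α Γ S k where
  state := M.start
  head := fun _ => 0
  tape := fun i z => if i = 0 ∧ 0 ≤ z then (w[z.toNat]?).map Sum.inl else none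

/-- One computation step; the value is `none` if the machine halts in the given configuration. -/
def step (M : DetTM α Γ S k) (C : Config α Γ S k) : Option (Config α Γ S k) :=
  (M.transition C.state (fun i => C.tape i (C.head i))).map fun r =>
    { state := r.1
      head := fun i => C.head i + (r.2.2 i).toInt
      tape := fun i => Function.update (C.tape i) (C.head i) (r.2.1 i) }

/-- The set of all tape cells (a tape together with a position on it) that are touched by a head
during the computation on input `w`. -/
def touchedCells (M : DetTM α Γ S k) (w : List α) : Set (Fin (k + 1) × ℤ) :=
  {c | ∃ C : Config α Γ S k,
    StateTransition.Reaches M.step (M.init w) C ∧ C.head c.1 = c.2}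

/-- `M` decides `L`: on every input it halts, in an accepting state exactly if the input
belongs to `L`. -/
def Decides (M : DetTM α Γ S k) (L : Language α) : Prop :=
  ∀ w : List α, ∃ C ∈ StateTransition.eval M.step (M.init w), (C.state ∈ M.accept ↔ w ∈ L)

/-- `M` works in linear space: the number of cells touched on an input is at most a constant
multiple of the length of the input (and at most a constant on the empty input, on which
the heads necessarily touch their starting cells). -/
def LinearSpace (M : DetTM α Γ S k) : Prop :=
  ∃ c : ℕ, ∀ w : List α, (M.touchedCells w).encard ≤ ((c * max 1 w.length : ℕ) : ℕ∞)

end DetTM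

/-- A language is deterministic context-sensitive if it is decided by a deterministic Turing
machine, with finitely many tapes, tape symbols and states, that works in linear space. -/
def IsDetContextSensitive {α : Type*} (L : Language α) : Prop :=
  ∃ (k : ℕ) (Γ S : Type) (_ : Finite Γ) (_ : Finite S) (M : DetTM α Γ S k),
    M.Decides L ∧ M.LinearSpace

end PrimitiveWords

namespace PrimitiveWords

/-! ### Powers, commuting words and rotations -/

section Words

variable {α : Type*}

/-! A nonempty word `w` is periodic exactly if `w = uv = vu` with `u`, `v` nonempty, because
commuting words are powers of a common word (`exists_wordPow_of_append_comm`). Equivalently, `w`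
occurs in `ww` somewhere other than as prefix or suffix (`isPeriodicWord_iff_shiftMatch`).

A machine can test this with `ww` on a second tape: it tries the shifts `i = 1, 2, …` until `w`
matches. Shift `|w|` always matches, and `w` is primitive exactly if no earlier one does. The shift
is stored in the distance between the heads, so no counter is needed and the heads stay between `-1`
and `2|w|` (`primTM_halts`).

Non-regularity is a Myhill–Nerode argument: for `i < j` the suffix `a^i b` separates `a^i b` from
`a^j b`, giving a square and a primitive word respectively. -/

theorem wordPow_add (v : List α) (m n : ℕ) : wordPow v (m + n) = wordPow v m ++ wordPow v n := by
  induction n with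
  | zero => simp [wordPow]
  | succ n ih => rw [← Nat.add_assoc, wordPow, ih, wordPow, List.append_assoc]

theorem wordPow_one (v : List α) : wordPow v 1 = v := rfl

theorem wordPow_succ_left (v : List α) (n : ℕ) : wordPow v (n + 1) = v ++ wordPow v n := by
  rw [Nat.add_comm, wordPow_add, wordPow_one]

theorem mem_of_mem_wordPow {v : List α} {n : ℕ} {x : α} (h : x ∈ wordPow v n) : x ∈ v := by
  induction n with
  | zero => simp [wordPow] at h
  | succ n ih =>
    rw [wordPow, List.mem_append] at h
    exact h.elim ih id

/-- Commuting words are powers of a common word. -/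
theorem exists_wordPow_of_append_comm (u v : List α) (h : u ++ v = v ++ u) :
    ∃ (t : List α) (m n : ℕ), u = wordPow t m ∧ v = wordPow t n := by
  induction hl : u.length + v.length using Nat.strong_induction_on generalizing u v with
  | _ N ih =>
  wlog huv : u.length ≤ v.length generalizing u v
  · obtain ⟨t, m, n, h₁, h₂⟩ := this v u h.symm (by omega) (by omega)
    exact ⟨t, n, m, h₂, h₁⟩
  rcases u.eq_nil_or_concat' with rfl | ⟨u', a, hu⟩
  · exact ⟨v, 0, 1, rfl, rfl⟩
  have hpos : 0 < u.length := by simp [hu]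
  -- Euclidean step: both words are prefixes of `uv = vu`, so the shorter one can be cancelled from
  -- the longer.
  obtain ⟨v', rfl⟩ : u <+: v :=
    List.prefix_of_prefix_length_le (List.prefix_append u v) (h ▸ List.prefix_append v u) huv
  have h' : u ++ v' = v' ++ u := by
    rw [List.append_assoc] at h
    exact List.append_cancel_left h
  obtain ⟨t, m, n, h₁, h₂⟩ := ih (u.length + v'.length)
    (by simp only [List.length_append] at hl; omega) u v' h' rfl
  exact ⟨t, m, m + n, h₁, by rw [wordPow_add, ← h₁, ← h₂]⟩

/-- A nonempty word is periodic exactly if it is a product of two nonempty commuting words. -/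
theorem isPeriodicWord_iff_append_comm {w : List α} :
    IsPeriodicWord w ↔
      ∃ u v : List α, u ≠ [] ∧ v ≠ [] ∧ w = u ++ v ∧ u ++ v = v ++ u := by
  constructor
  · rintro ⟨hw, v, n, hn, rfl⟩
    obtain ⟨n, rfl⟩ := Nat.exists_eq_add_of_le' hn
    have hv : v ≠ [] := by
      rintro rfl
      exact hw (List.eq_nil_iff_forall_not_mem.2 fun x hx =>
        List.not_mem_nil (mem_of_mem_wordPow hx))
    refine ⟨v, wordPow v (n + 1), hv, ?_, wordPow_succ_left v (n + 1), ?_⟩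
    · simp [wordPow, hv]
    · rw [← wordPow_succ_left, wordPow]
  · rintro ⟨u, v, hu, hv, rfl, h⟩
    obtain ⟨t, m, n, rfl, rfl⟩ := exists_wordPow_of_append_comm u v h
    refine ⟨by simp [hu], t, m + n, ?_, (wordPow_add t m n).symm⟩
    have hm : m ≠ 0 := by rintro rfl; exact hu rfl
    have hn : n ≠ 0 := by rintro rfl; exact hv rfl
    omega

/-- `w` matches the factor of length `|w|` of `w ++ w` which ends `i` letters before the end. -/
def ShiftMatch (w : List α) (i : ℕ) : Prop :=
  ∀ j < w.length, w[j]? = (w ++ w)[w.length + j - i]?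

theorem shiftMatch_length (w : List α) : ShiftMatch w w.length := by
  intro j hj
  rw [Nat.add_sub_cancel_left, List.getElem?_append_left hj]

/-- The factor of `w ++ w` starting at position `|w| - i` reads the last `i` letters of `w` and then
wraps around: it is a rotation of `w`. -/
theorem shiftMatch_iff {w : List α} {i : ℕ} (hi : i ≤ w.length) :
    ShiftMatch w i ↔
      w = w.drop (w.length - i) ++ w.take (w.length - i) := by
  constructor
  · intro h
    apply List.ext_getElem?
    intro j
    rcases lt_or_ge j w.length with hj | hj
    · rw [h j hj]
      simp only [List.getElem?_append, List.length_drop, List.getElem?_drop, List.getElem?_take]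
      split_ifs <;> first | omega | (congr 1; omega)
    · rw [List.getElem?_eq_none hj, List.getElem?_eq_none]
      simp only [List.length_append, List.length_drop, List.length_take]
      omega
  · intro h j hj
    conv_lhs => rw [h]
    simp only [List.getElem?_append, List.length_drop, List.getElem?_drop, List.getElem?_take]
    split_ifs <;> first | omega | (congr 1; omega)

theorem isPeriodicWord_iff_shiftMatch {w : List α} :
    IsPeriodicWord w ↔ ∃ i, 1 ≤ i ∧ i < w.length ∧ ShiftMatch w i := by
  rw [isPeriodicWord_iff_append_comm]
  constructor
  · rintro ⟨u, v, hu, hv, rfl, h⟩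
    have hu' := List.length_pos_iff.2 hu
    have hv' := List.length_pos_iff.2 hv
    refine ⟨v.length, hv', by simp [hu'], ?_⟩
    rw [shiftMatch_iff (by simp)]
    simpa using h
  · rintro ⟨i, h₁, h₂, h⟩
    rw [shiftMatch_iff h₂.le] at h
    refine ⟨w.take (w.length - i), w.drop (w.length - i), ?_, ?_,
      (List.take_append_drop _ _).symm, ?_⟩
    · rw [← List.length_pos_iff, List.length_take]
      omega
    · rw [← List.length_pos_iff, List.length_drop]
      omega
    · rw [List.take_append_drop, ← h]

end Words

/-! ### The set of primitive words is not regular -/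

section NotRegular

variable {α : Type*}

/-- A root `v` with exponent at least two has length at most `(i + j + 2) / 2 ≤ j`, so it lies
inside the leading block of `a`'s and cannot produce the letter `b`. -/
theorem isPrimitiveWord_replicate {a b : α} (hab : a ≠ b) {i j : ℕ} (hij : i < j) :
    IsPrimitiveWord (List.replicate j a ++ [b] ++ (List.replicate i a ++ [b])) := by
  refine ⟨by simp, ?_⟩
  rintro ⟨-, v, n, hn, h⟩
  obtain ⟨n, rfl⟩ := Nat.exists_eq_add_of_le' hn
  have hlen := congrArg List.length h
  rw [wordPow_succ_left, wordPow_succ_left] at hlen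
  simp only [List.length_append, List.length_replicate, List.length_singleton] at hlen
  have hpre : v <+: List.replicate j a := by
    apply List.prefix_of_prefix_length_le (l₃ := wordPow v (n + 2))
    · rw [wordPow_succ_left]
      exact List.prefix_append _ _
    · rw [← h, List.append_assoc]
      exact List.prefix_append _ _
    · rw [List.length_replicate]
      omega
  have hb : b ∈ wordPow v (n + 2) := by
    rw [← h]
    simp
  exact hab (List.eq_of_mem_replicate (hpre.subset (mem_of_mem_wordPow hb))).symm

theorem not_isRegular_primitiveWords [Nontrivial α] : ¬ (primitiveWords α).IsRegular := by
  rintro ⟨S, _, M, hM⟩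
  obtain ⟨a, b, hab⟩ := exists_pair_ne α
  obtain ⟨i, j, hij, h⟩ := Finite.exists_ne_map_eq_of_infinite
    fun i : ℕ => M.eval (List.replicate i a ++ [b])
  wlog hlt : i < j generalizing i j
  · exact this j i hij.symm h.symm (by omega)
  have hacc (x : List α) : M.eval x ∈ M.accept ↔ IsPrimitiveWord x := by
    rw [← DFA.mem_accepts, hM]
    rfl
  have hprim := isPrimitiveWord_replicate hab hlt
  rw [← hacc, DFA.eval, DFA.evalFrom_of_append, ← DFA.eval] at hprim
  rw [← h, DFA.eval, ← DFA.evalFrom_of_append, ← DFA.eval, hacc] at hprim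
  exact hprim.2 ⟨hprim.1, List.replicate i a ++ [b], 2, le_rfl, by simp [wordPow]⟩

end NotRegular

/-! ### Bounded computations -/

section Bounded

variable {α Γ S : Type*} {k : ℕ}

/-- A computation all of whose configurations, except possibly the last one, have their heads
in the interval from `-1` to `N`. -/
def BoundedReaches (M : DetTM α Γ S k) (N : ℕ) : Config α Γ S k → Config α Γ S k → Prop :=
  Relation.ReflTransGen fun C D => D ∈ M.step C ∧ ∀ i, C.head i ∈ Set.Icc (-1 : ℤ) N

theorem BoundedReaches.reaches {M : DetTM α Γ S k} {N : ℕ} {C D : Config α Γ S k}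
    (h : BoundedReaches M N C D) : StateTransition.Reaches M.step C D :=
  Relation.ReflTransGen.mono (fun _ _ h => h.1) _ _ h

/-- By determinism, every reachable configuration lies on the one run that ends in the halting
configuration `D`. -/
theorem BoundedReaches.head_mem {M : DetTM α Γ S k} {N : ℕ} {C D E : Config α Γ S k}
    (h : BoundedReaches M N C D) (hD : M.step D = none)
    (hb : ∀ i, D.head i ∈ Set.Icc (-1 : ℤ) N) (hE : StateTransition.Reaches M.step C E) :
    ∀ i, E.head i ∈ Set.Icc (-1 : ℤ) N := by
  induction h using Relation.ReflTransGen.head_induction_on with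
  | refl =>
    rcases hE.cases_head with rfl | ⟨F, hF, -⟩
    · exact hb
    · simp [hD] at hF
  | head h₁ _ ih =>
    rcases hE.cases_head with rfl | ⟨F, hF, hFE⟩
    · exact h₁.2
    · obtain rfl := Option.mem_unique hF h₁.1
      exact ih hFE

theorem touchedCells_encard_le {M : DetTM α Γ S k} {w : List α} {N : ℕ} {D : Config α Γ S k}
    (h : BoundedReaches M N (M.init w) D) (hD : M.step D = none)
    (hb : ∀ i, D.head i ∈ Set.Icc (-1 : ℤ) N) :
    (M.touchedCells w).encard ≤ ((k + 1) * (N + 2) : ℕ) := by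
  have hsub : M.touchedCells w ⊆
      ((Finset.univ ×ˢ Finset.Icc (-1 : ℤ) N : Finset (Fin (k + 1) × ℤ)) : Set _) := by
    rintro ⟨i, z⟩ ⟨E, hE, hz⟩
    replace hz : E.head i = z := hz
    simpa [hz] using h.head_mem hD hb hE i
  refine (Set.encard_le_encard hsub).trans ?_
  rw [Set.encard_coe_eq_coe_finsetCard, Finset.card_product, Finset.card_univ, Fintype.card_fin,
    Int.card_Icc]
  apply le_of_eq
  congr 2

end Bounded

/-! ### The machine -/

/-- The tape carrying the word `l` in the cells `0, …, |l| - 1`. -/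
def wordTape {α Γ : Type*} (l : List α) (z : ℤ) : TapeSymbol α Γ :=
  if 0 ≤ z then (l[z.toNat]?).map Sum.inl else none

section Tape

variable {α Γ : Type*}

theorem wordTape_natCast (l : List α) (j : ℕ) :
    wordTape (Γ := Γ) l j = (l[j]?).map Sum.inl := by
  simp [wordTape]

theorem wordTape_of_neg (l : List α) {z : ℤ} (hz : z < 0) :
    wordTape (Γ := Γ) l z = none := by
  simp [wordTape, hz]

theorem wordTape_length (l : List α) : wordTape (Γ := Γ) l l.length = none := by
  simp [wordTape_natCast]

theorem wordTape_nil : wordTape (Γ := Γ) ([] : List α) = fun _ => none := by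
  ext z
  simp [wordTape]

theorem exists_wordTape_eq_some (l : List α) {z : ℤ} (h₀ : 0 ≤ z) (h : z < l.length) :
    ∃ s, wordTape (Γ := Γ) l z = some s := by
  lift z to ℕ using h₀
  rw [wordTape_natCast, List.getElem?_eq_getElem (by omega)]
  exact ⟨_, rfl⟩

theorem update_wordTape (l : List α) (a : α) :
    Function.update (wordTape (Γ := Γ) l) l.length (some (Sum.inl a)) = wordTape (l ++ [a]) := by
  funext z
  rcases eq_or_ne z l.length with rfl | hz
  · simp [wordTape_natCast]
  · rw [Function.update_of_ne hz]
    rcases lt_or_ge z 0 with h | h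
    · rw [wordTape_of_neg _ h, wordTape_of_neg _ h]
    · lift z to ℕ using h
      rw [wordTape_natCast, wordTape_natCast]
      congr 1
      rw [List.getElem?_append]
      split_ifs with h
      · rfl
      · rw [List.getElem?_eq_none (by omega), List.getElem?_eq_none]
        simp only [List.length_singleton]
        omega

end Tape

/-- The states of the machine deciding primitivity. -/
inductive PrimState where
  | start
  | copyFirst
  | rewind
  | copySecond
  | forward
  | compare
  | accept

instance : Finite PrimState :=
  Finite.of_surjective
    (fun i : Fin 7 => (![.start, .copyFirst, .rewind, .copySecond, .forward, .compare, .accept] :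
      Fin 7 → PrimState) i)
    fun s => by
      cases s
      exacts [⟨0, rfl⟩, ⟨1, rfl⟩, ⟨2, rfl⟩, ⟨3, rfl⟩, ⟨4, rfl⟩, ⟨5, rfl⟩, ⟨6, rfl⟩]

section Machine

variable {α : Type*}

open Classical in
/-- The program of the machine. The input tape is never changed. The second tape first receives
two copies of the input `w`; then `w` is compared, from right to left, with the
factors of `w ++ w` that end `1, 2, …` letters before the end, until a match is found. The
arguments are the state and the two scanned symbols, the result consists of the new state, the
symbol written on the second tape and the two head movements. -/
noncomputable def primProgram : PrimState → TapeSymbol α Empty → TapeSymbol α Empty →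
    Option (PrimState × TapeSymbol α Empty × Move × Move)
  | .start, none, _ => none
  | .start, some _, y => some (.copyFirst, y, .stay, .stay)
  | .copyFirst, some x, _ => some (.copyFirst, some x, .right, .right)
  | .copyFirst, none, y => some (.rewind, y, .left, .stay)
  | .rewind, some _, y => some (.rewind, y, .left, .stay)
  | .rewind, none, y => some (.copySecond, y, .right, .stay)
  | .copySecond, some x, _ => some (.copySecond, some x, .right, .right)
  | .copySecond, none, y => some (.forward, y, .stay, .left)
  | .forward, some _, y => some (.forward, y, .right, .right)
  | .forward, none, y => some (.compare, y, .left, .left)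
  | .compare, some x, y =>
    if some x = y then some (.compare, y, .left, .left) else some (.forward, y, .right, .stay)
  | .compare, none, none => some (.accept, none, .stay, .stay)
  | .compare, none, some _ => none
  | .accept, _, _ => none

/-- A two-tape machine deciding the set of primitive words. -/
noncomputable def primTM (α : Type*) : DetTM α Empty PrimState 1 where
  start := .start
  accept := {.accept}
  transition s r := (primProgram s (r 0) (r 1)).map fun q =>
    (q.1, ![r 0, q.2.1], ![q.2.2.1, q.2.2.2])

/-- A configuration of a two-tape machine. -/
def pairConfig (s : PrimState) (x y : ℤ) (t u : ℤ → TapeSymbol α Empty) :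
    Config α Empty PrimState 1 where
  state := s
  head := ![x, y]
  tape := ![t, u]

theorem primTM_init (w : List α) :
    (primTM α).init w = pairConfig .start 0 0 (wordTape w) (wordTape []) := by
  simp only [DetTM.init, pairConfig, primTM, Config.mk.injEq, true_and]
  constructor
  · ext i
    fin_cases i <;> rfl
  · funext i z
    fin_cases i <;> simp [wordTape]

theorem primTM_step (s : PrimState) (x y : ℤ) (t u : ℤ → TapeSymbol α Empty) :
    (primTM α).step (pairConfig s x y t u) = (primProgram s (t x) (u y)).map fun q =>
      pairConfig q.1 (x + q.2.2.1.toInt) (y + q.2.2.2.toInt) t (Function.update u y q.2.1) := by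
  simp only [DetTM.step, pairConfig, primTM, Option.map_map]
  congr 1
  funext q
  simp only [Function.comp, Config.mk.injEq, true_and]
  constructor
  · ext i
    fin_cases i <;> rfl
  · funext i
    fin_cases i <;> simp

/-! ### Segments of the computation -/

theorem primTM_step_bounded {N : ℕ} {s : PrimState} {x y : ℤ} {t u : ℤ → TapeSymbol α Empty}
    {D : Config α Empty PrimState 1} {q : PrimState × TapeSymbol α Empty × Move × Move}
    (hq : primProgram s (t x) (u y) = some q) (hx : -1 ≤ x ∧ x ≤ N) (hy : -1 ≤ y ∧ y ≤ N)
    (hD : BoundedReaches (primTM α) N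
      (pairConfig q.1 (x + q.2.2.1.toInt) (y + q.2.2.2.toInt) t (Function.update u y q.2.1)) D) :
    BoundedReaches (primTM α) N (pairConfig s x y t u) D := by
  refine Relation.ReflTransGen.head ⟨?_, ?_⟩ hD
  · rw [primTM_step, hq]
    rfl
  · intro i
    fin_cases i
    exacts [hx, hy]

/-- A step that does not change the tapes. -/
theorem primTM_move {N : ℕ} {s s' : PrimState} {x y x' y' : ℤ} {t u : ℤ → TapeSymbol α Empty}
    {D : Config α Empty PrimState 1} {m m' : Move}
    (hq : primProgram s (t x) (u y) = some (s', u y, m, m'))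
    (hx : -1 ≤ x ∧ x ≤ N) (hy : -1 ≤ y ∧ y ≤ N)
    (hx' : x' = x + m.toInt) (hy' : y' = y + m'.toInt)
    (hD : BoundedReaches (primTM α) N (pairConfig s' x' y' t u) D) :
    BoundedReaches (primTM α) N (pairConfig s x y t u) D := by
  subst hx' hy'
  refine primTM_step_bounded hq hx hy ?_
  simpa only [Function.update_eq_self] using hD

/-- One invariant serves both copying phases: `p` is what the second tape held before (empty, then
`w`), `l` the part already copied and `r` the rest. -/
theorem copy_loop {w : List α} {s : PrimState} (hs : s = .copyFirst ∨ s = .copySecond)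
    (p : List α) (hp : p.length ≤ w.length) (r : List α) : ∀ l : List α, w = l ++ r →
    BoundedReaches (primTM α) (2 * w.length)
      (pairConfig s l.length (p ++ l).length (wordTape w) (wordTape (p ++ l)))
      (pairConfig s w.length (p ++ w).length (wordTape w) (wordTape (p ++ w))) := by
  induction r with
  | nil =>
    rintro l rfl
    rw [List.append_nil]
    exact .refl
  | cons a r ih =>
    intro l hl
    have hlen := congrArg List.length hl
    simp only [List.length_append, List.length_cons] at hlen
    have ha : wordTape (Γ := Empty) w l.length = some (Sum.inl a) := by
      rw [wordTape_natCast, hl]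
      simp
    refine primTM_step_bounded (q := (s, some (Sum.inl a), .right, .right)) ?_ ?_ ?_ ?_
    · rw [ha]
      rcases hs with rfl | rfl <;> rfl
    · constructor <;> push_cast <;> omega
    · simp only [List.length_append]
      constructor <;> push_cast <;> omega
    · rw [update_wordTape]
      simpa [Move.toInt, add_assoc] using ih (l ++ [a]) (by simpa using hl)

theorem rewind_loop {w : List α} {u : ℤ → TapeSymbol α Empty} {y : ℤ}
    (hy : -1 ≤ y ∧ y ≤ 2 * w.length) (j : ℕ) (hj : j ≤ w.length) :
    BoundedReaches (primTM α) (2 * w.length)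
      (pairConfig .rewind (j - 1) y (wordTape w) u) (pairConfig .rewind (-1) y (wordTape w) u) := by
  induction j with
  | zero => exact .refl
  | succ j ih =>
    obtain ⟨c, hc⟩ := exists_wordTape_eq_some (Γ := Empty) w (z := j) (by omega) (by omega)
    refine primTM_move (s' := .rewind) (m := .left) (m' := .stay) ?_ ?_ ?_ ?_ ?_ (ih (by omega))
    · push_cast
      rw [add_sub_cancel_right, hc]
      rfl
    · constructor <;> push_cast <;> omega
    · exact_mod_cast hy
    · simp [Move.toInt]
      ring
    · simp [Move.toInt]

/-- The heads move in parallel, so their distance, which encodes the current shift, is kept. -/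
theorem forward_loop {w : List α} {u : ℤ → TapeSymbol α Empty} (d : ℕ) :
    ∀ {x y : ℤ}, 0 ≤ x → x + d = w.length → -1 ≤ y → y + d ≤ 2 * w.length →
    BoundedReaches (primTM α) (2 * w.length)
      (pairConfig .forward x y (wordTape w) u)
      (pairConfig .forward w.length (y + d) (wordTape w) u) := by
  induction d with
  | zero =>
    intro x y _ h _ _
    obtain rfl : x = w.length := by simpa using h
    rw [Nat.cast_zero, add_zero]
    exact .refl
  | succ d ih =>
    intro x y hx h hy h'
    push_cast at h h' ⊢
    obtain ⟨c, hc⟩ := exists_wordTape_eq_some (Γ := Empty) w hx (by omega)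
    refine primTM_move (s' := .forward) (m := .right) (m' := .right) (x' := x + 1) (y' := y + 1)
      ?_ ?_ ?_ rfl rfl ?_
    · rw [hc]
      rfl
    · constructor <;> push_cast <;> omega
    · constructor <;> push_cast <;> omega
    · have := ih (x := x + 1) (y := y + 1) (by omega) (by omega) (by omega) (by omega)
      rwa [add_assoc y 1, add_comm (1 : ℤ)] at this

/-- The scanned symbols agree exactly if the letters at the corresponding positions do. -/
theorem wordTape_eq_iff {w : List α} {i j : ℕ} (hi : i ≤ w.length) :
    wordTape (Γ := Empty) w j = wordTape (w ++ w) (w.length + j - i) ↔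
      w[j]? = (w ++ w)[w.length + j - i]? := by
  -- Since `i ≤ w.length`, the subtraction of naturals is not truncated.
  rw [show (w.length + j - i : ℤ) = ((w.length + j - i : ℕ) : ℤ) by omega, wordTape_natCast,
    wordTape_natCast]
  exact (Option.map_injective Sum.inl_injective).eq_iff

/-- Comparing the letters at the positions below `j`. -/
theorem compare_loop_match {w : List α} {i : ℕ} (hi : i ≤ w.length) (h : ShiftMatch w i)
    (j : ℕ) (hj : j ≤ w.length) :
    BoundedReaches (primTM α) (2 * w.length)
      (pairConfig .compare (j - 1) (w.length + j - i - 1) (wordTape w) (wordTape (w ++ w)))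
      (pairConfig .compare (-1) (w.length - i - 1) (wordTape w) (wordTape (w ++ w))) := by
  induction j with
  | zero =>
    simp only [Nat.cast_zero, zero_sub, add_zero]
    exact .refl
  | succ j ih =>
    have heq := (wordTape_eq_iff hi).2 (h j (by omega))
    obtain ⟨c, hc⟩ := exists_wordTape_eq_some (Γ := Empty) w (z := j) (by omega) (by omega)
    rw [show ((j + 1 : ℕ) : ℤ) - 1 = j by omega,
      show (w.length + (j + 1 : ℕ) - i - 1 : ℤ) = w.length + j - i by omega]
    refine primTM_move (s' := .compare) (m := .left) (m' := .left) ?_ ?_ ?_ rfl rfl (ih (by omega))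
    · rw [← heq, hc]
      simp [primProgram]
    · constructor <;> push_cast <;> omega
    · constructor <;> push_cast <;> omega

theorem compare_loop_mismatch {w : List α} {i : ℕ} (hi : i ≤ w.length) (j : ℕ)
    (hj : j ≤ w.length) (h : ∃ j' < j, w[j']? ≠ (w ++ w)[w.length + j' - i]?) :
    BoundedReaches (primTM α) (2 * w.length)
      (pairConfig .compare (j - 1) (w.length + j - i - 1) (wordTape w) (wordTape (w ++ w)))
      (pairConfig .forward w.length (2 * w.length - (i + 1 : ℕ)) (wordTape w)
        (wordTape (w ++ w))) := by
  induction j with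
  | zero =>
    obtain ⟨j', hj', -⟩ := h
    omega
  | succ j ih =>
    obtain ⟨c, hc⟩ := exists_wordTape_eq_some (Γ := Empty) w (z := j) (by omega) (by omega)
    rw [show ((j + 1 : ℕ) : ℤ) - 1 = j by omega,
      show (w.length + (j + 1 : ℕ) - i - 1 : ℤ) = w.length + j - i by omega]
    have hx : -1 ≤ (j : ℤ) ∧ (j : ℤ) ≤ (2 * w.length : ℕ) := by
      constructor <;> push_cast <;> omega
    have hy : -1 ≤ (w.length + j - i : ℤ) ∧ (w.length + j - i : ℤ) ≤ (2 * w.length : ℕ) := by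
      constructor <;> push_cast <;> omega
    by_cases heq : w[j]? = (w ++ w)[w.length + j - i]?
    · refine primTM_move (s' := .compare) (m := .left) (m' := .left) ?_ hx hy rfl rfl
        (ih (by omega) ?_)
      · rw [← (wordTape_eq_iff hi).2 heq, hc]
        simp [primProgram]
      · obtain ⟨j', hj', hne⟩ := h
        exact ⟨j', by grind, hne⟩
    · have hne := mt (wordTape_eq_iff hi).1 heq
      rw [hc] at hne
      -- Only the input head moves here; this changes the distance of the heads by one and so raises
      -- the shift to `i + 1`.
      refine primTM_move (s' := .forward) (m := .right) (m' := .stay) (x' := j + 1)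
        (y' := w.length + j - i) ?_ hx hy rfl (by simp [Move.toInt]) ?_
      · rw [hc, primProgram, if_neg hne]
      · have := forward_loop (w := w) (u := wordTape (w ++ w)) (w.length - (j + 1))
          (x := j + 1) (y := w.length + j - i) (by omega) (by omega) (by omega) (by omega)
        rwa [show (w.length + j - i + (w.length - (j + 1) : ℕ) : ℤ) =
          2 * w.length - (i + 1 : ℕ) by omega] at this

theorem forward_step {w : List α} {i : ℕ} (hi : i ≤ w.length) {D : Config α Empty PrimState 1}
    (hD : BoundedReaches (primTM α) (2 * w.length)
      (pairConfig .compare (w.length - 1) (w.length + w.length - i - 1) (wordTape w)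
        (wordTape (w ++ w))) D) :
    BoundedReaches (primTM α) (2 * w.length)
      (pairConfig .forward w.length (2 * w.length - i) (wordTape w) (wordTape (w ++ w))) D := by
  refine primTM_move (s' := .compare) (m := .left) (m' := .left) ?_ ?_ ?_ rfl ?_ hD
  · rw [wordTape_length]
    rfl
  · constructor <;> push_cast <;> omega
  · constructor <;> push_cast <;> omega
  · simp only [Move.toInt]
    ring

/-- The shifts without a match are passed. -/
theorem shift_loop {w : List α} (i : ℕ) (hi : i < w.length)
    (h : ∀ i', 1 ≤ i' → i' ≤ i → ¬ ShiftMatch w i') :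
    BoundedReaches (primTM α) (2 * w.length)
      (pairConfig .forward w.length (2 * w.length - (1 : ℕ)) (wordTape w) (wordTape (w ++ w)))
      (pairConfig .forward w.length (2 * w.length - (i + 1 : ℕ)) (wordTape w)
        (wordTape (w ++ w))) := by
  induction i with
  | zero => exact .refl
  | succ i ih =>
    refine Relation.ReflTransGen.trans (ih (by omega) fun i' h₁ h₂ => h i' h₁ (by omega)) ?_
    refine forward_step hi.le (compare_loop_mismatch hi.le _ le_rfl ?_)
    have := h (i + 1) (by omega) le_rfl
    simpa [ShiftMatch] using this

/-- The preparation of the second tape. -/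
theorem prepare {w : List α} (hw : w ≠ []) :
    BoundedReaches (primTM α) (2 * w.length) ((primTM α).init w)
      (pairConfig .forward w.length (2 * w.length - (1 : ℕ)) (wordTape w)
        (wordTape (w ++ w))) := by
  have hpos := List.length_pos_iff.2 hw
  have hb (z : ℤ) (h₁ : -1 ≤ z) (h₂ : z ≤ 2 * w.length) : -1 ≤ z ∧ z ≤ (2 * w.length : ℕ) := by
    constructor <;> push_cast <;> omega
  rw [primTM_init]
  obtain ⟨c, hc⟩ := exists_wordTape_eq_some (Γ := Empty) w (z := 0) le_rfl (by omega)
  refine primTM_move (s' := .copyFirst) (m := .stay) (m' := .stay) (by rw [hc]; rfl)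
    (hb _ (by omega) (by omega)) (hb _ (by omega) (by omega)) rfl rfl ?_
  refine Relation.ReflTransGen.trans (copy_loop (.inl rfl) [] (by simp) w [] rfl) ?_
  simp only [List.nil_append]
  refine primTM_move (s' := .rewind) (m := .left) (m' := .stay) (by rw [wordTape_length]; rfl)
    (hb _ (by omega) (by omega)) (hb _ (by omega) (by omega)) rfl
    (by simp only [Move.toInt]; exact (add_zero _).symm) ?_
  refine Relation.ReflTransGen.trans
    (rewind_loop ⟨by omega, by omega⟩ w.length le_rfl) ?_
  refine primTM_move (s' := .copySecond) (m := .right) (m' := .stay) (x' := 0)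
    (by rw [wordTape_of_neg _ (by omega)]; rfl)
    (hb _ (by omega) (by omega)) (hb _ (by omega) (by omega)) rfl
    (by simp only [Move.toInt]; exact (add_zero _).symm) ?_
  have hcopy := copy_loop (s := .copySecond) (.inr rfl) w le_rfl w [] rfl
  rw [List.append_nil] at hcopy
  refine Relation.ReflTransGen.trans hcopy ?_
  simp only [List.length_append, Nat.cast_add]
  exact primTM_move (s' := .forward) (m := .stay) (m' := .left) (by rw [wordTape_length]; rfl)
    (hb _ (by omega) (by omega)) (hb _ (by omega) (by omega))
    (by simp only [Move.toInt]; exact (add_zero _).symm)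
    (by simp only [Move.toInt]; push_cast; ring) .refl

/-- The run stops at the least matching shift `i ≥ 1`, with the second head on cell `|w| - i - 1`.
This is the blank cell `-1` if `i = |w|`, and carries a letter of `w ++ w` otherwise; the machine
accepts in the first case only. -/
theorem primTM_halts (w : List α) :
    ∃ D, BoundedReaches (primTM α) (2 * w.length) ((primTM α).init w) D ∧
      (primTM α).step D = none ∧ (∀ i, D.head i ∈ Set.Icc (-1 : ℤ) (2 * w.length : ℕ)) ∧
      (D.state ∈ (primTM α).accept ↔ w ∈ primitiveWords α) := by
  classical
  rcases eq_or_ne w [] with rfl | hw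
  · refine ⟨_, .refl, ?_, ?_, ?_⟩
    · rw [primTM_init, primTM_step, wordTape_nil]
      rfl
    · intro i
      simp [DetTM.init]
    · exact iff_of_false PrimState.noConfusion fun h => h.1 rfl
  have hpos := List.length_pos_iff.2 hw
  have hex : ∃ i, 1 ≤ i ∧ ShiftMatch w i := ⟨w.length, hpos, shiftMatch_length w⟩
  obtain ⟨h₁, hmatch⟩ := Nat.find_spec hex
  have hle : Nat.find hex ≤ w.length := Nat.find_min' hex ⟨hpos, shiftMatch_length w⟩
  have hmin : ∀ i, 1 ≤ i → i < Nat.find hex → ¬ ShiftMatch w i :=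
    fun i h₁ h h' => Nat.find_min hex h ⟨h₁, h'⟩
  generalize Nat.find hex = i at h₁ hmatch hle hmin
  have hrun : BoundedReaches (primTM α) (2 * w.length) ((primTM α).init w)
      (pairConfig .compare (-1) (w.length - i - 1) (wordTape w) (wordTape (w ++ w))) := by
    refine Relation.ReflTransGen.trans (prepare hw) ?_
    refine Relation.ReflTransGen.trans
      (shift_loop (i - 1) (by omega) fun i' h h' => hmin i' h (by omega)) ?_
    rw [Nat.sub_add_cancel h₁]
    exact forward_step hle (compare_loop_match hle hmatch _ le_rfl)
  have hmem : w ∈ primitiveWords α ↔ i = w.length := by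
    change w ≠ [] ∧ ¬ IsPeriodicWord w ↔ _
    rw [isPeriodicWord_iff_shiftMatch]
    constructor
    · rintro ⟨-, h⟩
      by_contra hne
      exact h ⟨i, h₁, by omega, hmatch⟩
    · rintro rfl
      exact ⟨hw, fun ⟨i', h, h', hm⟩ => hmin i' h h' hm⟩
  rw [hmem]
  rcases eq_or_ne i w.length with rfl | hne
  · refine ⟨pairConfig .accept (-1) (-1) (wordTape w) (wordTape (w ++ w)),
      Relation.ReflTransGen.trans hrun ?_, ?_, ?_, ?_⟩
    · refine primTM_move (s' := .accept) (m := .stay) (m' := .stay) ?_ ?_ ?_ rfl ?_ .refl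
      · rw [wordTape_of_neg w (by omega), wordTape_of_neg _ (by omega)]
        rfl
      · exact ⟨le_rfl, by omega⟩
      · constructor <;> push_cast <;> omega
      · simp [Move.toInt]
    · rw [primTM_step]
      rfl
    · intro i
      fin_cases i <;> simp [pairConfig] <;> omega
    · simp [pairConfig, primTM]
  · refine ⟨_, hrun, ?_, ?_, ?_⟩
    · obtain ⟨c, hc⟩ := exists_wordTape_eq_some (Γ := Empty) (w ++ w) (z := w.length - i - 1)
        (by omega) (by simp only [List.length_append]; omega)
      rw [primTM_step, wordTape_of_neg w (by omega), hc]
      rfl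
    · intro i
      fin_cases i <;> simp [pairConfig] <;> omega
    · simp [pairConfig, primTM, hne]

theorem isDetContextSensitive_primitiveWords : IsDetContextSensitive (primitiveWords α) := by
  -- Two tapes with `2|w| + 2` cells each make `4|w| + 4 ≤ 8 * max 1 |w|`.
  refine ⟨1, Empty, PrimState, inferInstance, inferInstance, primTM α, fun w => ?_, 8, fun w => ?_⟩
  · obtain ⟨D, hD, hhalt, -, hacc⟩ := primTM_halts w
    exact ⟨D, StateTransition.mem_eval.2 ⟨hD.reaches, hhalt⟩, hacc⟩
  · obtain ⟨D, hD, hhalt, hb, -⟩ := primTM_halts w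
    refine (touchedCells_encard_le hD hhalt hb).trans ?_
    exact_mod_cast (by omega : (1 + 1) * (2 * w.length + 2) ≤ 8 * max 1 w.length)

end Machine

end PrimitiveWords

theorem theorem19 (α : Type*) [Finite α] [Nontrivial α] :
    PrimitiveWords.IsDetContextSensitive (PrimitiveWords.primitiveWords α) ∧
      ¬ (PrimitiveWords.primitiveWords α).IsRegular := by
  exact ⟨PrimitiveWords.isDetContextSensitive_primitiveWords,
    PrimitiveWords.not_isRegular_primitiveWords⟩
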